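/- Let $1 < p < \infty$ and let $L^p([0,1])$ be the space of complex-valued $p$-integrable functions on $[0,1]$ with respect to Lebesgue measure. Let $\varphi \colon [0,1] \to \mathbf{R}$ be a continuous, strictly increasing, convex function with $\varphi(0) = 0$ which extends to a holomorphic function on an open neighborhood of $[0,1]$ in $\mathbf{C}$. For $\alpha \in [0,1]$ let $T_{\varphi,\alpha}$ be the weighted translation operator on $L^p([0,1])$ defined by $$T_{\varphi,\alpha} f(x) = \varphi(x)\, f(\{x+\alpha\}) \quad \text{for a.e. } x \in [0,1],$$ where $\{\cdot\}$ denotes the fractional part. Then the set of all $\alpha \in [0,1]$ for which $T_{\varphi,\alpha}$ is cyclic, i.e. for which there exists $f \in L^p([0,1])$ such that the linear span of $\{T_{\varphi,\alpha}^n f : n \geq 0\}$ is dense in $L^p([0,1])$, is co-meager in $[0,1]$ (it contains a dense $G_\delta$ subset of $[0,1]$). -/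

import Mathlib

open MeasureTheory Set
open scoped ENNReal

/-- A bounded operator `T` on a complex normed space is cyclic if there is a vector `x` such that
the linear span of the orbit `{T ^ n x ; n ≥ 0}` is dense. -/
def IsCyclicOperator {X : Type*} [NormedAddCommGroup X] [NormedSpace ℂ X] (T : X →L[ℂ] X) : Prop :=
  ∃ x : X, Dense (Submodule.span ℂ (Set.range fun n : ℕ => (T ^ n) x) : Set X)

/-- Lebesgue measure on `[0, 1]`. -/
noncomputable def lebesgue01 : Measure ℝ := volume.restrict (Icc (0 : ℝ) 1)

/-- The map `x ↦ {x + α}` (fractional part) preserves Lebesgue measure on `[0, 1]`. -/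
theorem measurePreserving_fract_add (α : ℝ) :
    MeasurePreserving (fun x : ℝ => Int.fract (x + α)) lebesgue01 lebesgue01 := by
  have hm : Measurable (fun x : ℝ => Int.fract (x + α)) := (measurable_id.add_const α).fract
  refine ⟨hm, ?_⟩
  ext s hs
  have hA : MeasurableSet (Int.fract ⁻¹' s : Set ℝ) := measurable_fract hs
  have hIoc : lebesgue01 = volume.restrict (Ioc (0 : ℝ) 1) :=
    (restrict_Ioc_eq_restrict_Icc).symm
  have hIco : lebesgue01 = volume.restrict (Ico (0 : ℝ) 1) :=
    (restrict_Ico_eq_restrict_Icc).symm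
  have h1 : volume ((Int.fract ⁻¹' s : Set ℝ) ∩ Ioc α (α + 1))
      = volume ((Int.fract ⁻¹' s : Set ℝ) ∩ Ioc 0 (0 + 1)) := by
    refine (isAddFundamentalDomain_Ioc one_pos α).measure_set_eq
      (isAddFundamentalDomain_Ioc one_pos 0) hA ?_
    rintro ⟨g, n, rfl⟩
    ext x
    simp [AddSubgroup.vadd_def]
  rw [Measure.map_apply hm hs]
  calc lebesgue01 ((fun x : ℝ => Int.fract (x + α)) ⁻¹' s)
      = volume ((fun x : ℝ => x + α) ⁻¹' ((Int.fract ⁻¹' s : Set ℝ) ∩ Ioc α (α + 1))) := by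
        rw [hIoc, Measure.restrict_apply (hm hs)]
        congr 1
        ext x
        simp [add_comm α 1]
    _ = volume ((Int.fract ⁻¹' s : Set ℝ) ∩ Ioc α (α + 1)) := measure_preimage_add_right _ _ _
    _ = volume.restrict (Ioc (0 : ℝ) 1) (Int.fract ⁻¹' s) := by
        rw [h1, Measure.restrict_apply hA, zero_add]
    _ = volume.restrict (Ico (0 : ℝ) 1) (Int.fract ⁻¹' s) := by rw [← hIoc, hIco]
    _ = lebesgue01 s := by
        rw [hIco, Measure.restrict_apply hA, Measure.restrict_apply hs]
        congr 1
        ext x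
        simp only [mem_inter_iff, mem_preimage]
        refine and_congr_left fun hx => ?_
        rw [Int.fract_eq_self.2 ⟨hx.1, hx.2⟩]

/-- The multiplication operator `M_φ f = φ f` on `L^p([0, 1])`, for `φ ∈ L^∞([0, 1])`. -/
noncomputable def multiplicationOp (p : ℝ≥0∞) [Fact (1 ≤ p)] (φ : Lp ℂ ∞ lebesgue01) :
    Lp ℂ p lebesgue01 →L[ℂ] Lp ℂ p lebesgue01 :=
  (ContinuousLinearMap.mul ℂ ℂ).holderL lebesgue01 ∞ p p φ

/-- The translation operator `U_α f = f ({· + α})` on `L^p([0, 1])`. -/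
noncomputable def translationOp (p : ℝ≥0∞) [Fact (1 ≤ p)] (α : ℝ) :
    Lp ℂ p lebesgue01 →L[ℂ] Lp ℂ p lebesgue01 :=
  (Lp.compMeasurePreservingₗᵢ ℂ (fun x : ℝ => Int.fract (x + α))
    (measurePreserving_fract_add α)).toContinuousLinearMap

/-- The weighted translation operator `T_{φ, α} = M_φ U_α` on `L^p([0, 1])`, i.e.
`T_{φ, α} f (x) = φ(x) f({x + α})` for almost every `x ∈ [0, 1]`. -/
noncomputable def weightedTranslation (p : ℝ≥0∞) [Fact (1 ≤ p)] (φ : Lp ℂ ∞ lebesgue01) (α : ℝ) :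
    Lp ℂ p lebesgue01 →L[ℂ] Lp ℂ p lebesgue01 :=
  multiplicationOp p φ ∘L translationOp p α

theorem weightedTranslation_ae_eq (p : ℝ≥0∞) [Fact (1 ≤ p)] (φ : Lp ℂ ∞ lebesgue01) (α : ℝ)
    (f : Lp ℂ p lebesgue01) :
    weightedTranslation p φ α f =ᵐ[lebesgue01] fun x => φ x * f (Int.fract (x + α)) := by
  have h1 := (ContinuousLinearMap.mul ℂ ℂ).coeFn_holder (r := p) φ (translationOp p α f)
  have h2 : translationOp p α f =ᵐ[lebesgue01] f ∘ fun x : ℝ => Int.fract (x + α) :=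
    Lp.coeFn_compMeasurePreserving f (measurePreserving_fract_add α)
  have h3 : weightedTranslation p φ α f
      = (ContinuousLinearMap.mul ℂ ℂ).holder p φ (translationOp p α f) := rfl
  rw [h3]
  filter_upwards [h1, h2] with x hx1 hx2
  rw [hx1, hx2]
  simp

/-- A continuous real function on `[0, 1]` defines an element of (complex) `L^∞([0, 1])`. -/
theorem memLp_top_of_continuousOn {φ : ℝ → ℝ} (hφ : ContinuousOn φ (Icc 0 1)) :
    MemLp (fun x => (φ x : ℂ)) ∞ lebesgue01 := by
  have hc : ContinuousOn (fun x => (φ x : ℂ)) (Icc 0 1) :=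
    Complex.continuous_ofReal.comp_continuousOn hφ
  obtain ⟨C, hC⟩ := isCompact_Icc.exists_bound_of_continuousOn hc
  exact memLp_top_of_bound (hc.aestronglyMeasurable measurableSet_Icc) C
    ((ae_restrict_iff' measurableSet_Icc).2 (Filter.Eventually.of_forall hC))

/-- The class in `L^∞([0, 1])` of a continuous function `φ : [0, 1] → ℝ`. -/
noncomputable def weightOfContinuousOn (φ : ℝ → ℝ) (hφ : ContinuousOn φ (Icc 0 1)) :
    Lp ℂ ∞ lebesgue01 :=
  (memLp_top_of_continuousOn hφ).toLp (fun x => (φ x : ℂ))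

/-!
The operators `T_α` depend on `α` continuously in the strong operator topology. A Baire category
argument (`residual_isCyclicOperator`) therefore reduces the claim to a dense set of parameters `α`
for which the cyclic vectors of `T_α` are dense in `L^p`. The rational parameters `α = r / q` have
this property.

For `α = r / q` in lowest terms the power `T_α ^ q` is the multiplication by
`Φ(x) = φ(x) φ({x + α}) ⋯ φ({x + (q - 1) α})`. Since `φ` is nonnegative and strictly increasing,
`Φ` is strictly increasing on each cell `(k / q, (k + 1) / q)` (`weightCocycle_lt`). This monotonicity
has two consequences.

* The level sets of `Φ` are null, so `T_α ^ q - a ^ q`, and with it its left factor `T_α - a`, has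
  dense range for every complex `a`. Hence `P(T_α)` has dense range for each polynomial `P ≠ 0`, and
  one cyclic vector `x` produces a dense set of cyclic vectors `P(T_α) x`
  (`dense_setOf_cyclic_vector`).
* The indicator function of the cell `(0, 1 / q)` is a cyclic vector
  (`isCyclicOperator_weightedTranslation_div`). Indeed `Φ` is injective on this cell, so polynomials
  in `Φ` are dense in `L^p(0, 1 / q)`, by push-forward under `Φ` and the Weierstrass theorem
  (`exists_polynomial_comp_eLpNorm_sub_le`). The closed span of the orbit thus contains
  `L^p(0, 1 / q)`. Being invariant under `T_α`, which has dense range and carries functions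
  supported in `E` to functions supported in `E - α` modulo `1`, it contains `L^p` of every cell.
-/

/-! ### Cyclic vectors of an operator -/

section Operator

open Polynomial

variable {E : Type*} [NormedAddCommGroup E] [NormedSpace ℂ E]

theorem span_orbit_eq_range_aeval (T : E →L[ℂ] E) (x : E) :
    (Submodule.span ℂ (range fun n : ℕ => (T ^ n) x) : Set E)
      = range fun P : ℂ[X] => aeval T P x := by
  have hspan : Submodule.span ℂ (range fun n : ℕ => (T ^ n) x)
      = LinearMap.range ((ContinuousLinearMap.apply ℂ E x : (E →L[ℂ] E) →ₗ[ℂ] E) ∘ₗ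
          (aeval T : ℂ[X] →ₐ[ℂ] (E →L[ℂ] E)).toLinearMap) := by
    apply le_antisymm
    · rw [Submodule.span_le]
      rintro _ ⟨n, rfl⟩
      exact ⟨X ^ n, by simp⟩
    · rintro _ ⟨P, rfl⟩
      induction P using Polynomial.induction_on' with
      | add P Q hP hQ => rw [map_add]; exact add_mem hP hQ
      | monomial n c =>
        simp only [LinearMap.comp_apply, AlgHom.toLinearMap_apply, aeval_monomial]
        simpa [Algebra.algebraMap_eq_smul_one] using Submodule.smul_mem _ c
          (Submodule.subset_span (s := range fun n : ℕ => (T ^ n) x) ⟨n, rfl⟩)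
  rw [hspan]
  ext y
  simp

theorem denseRange_aeval {T : E →L[ℂ] E}
    (hT : ∀ a : ℂ, DenseRange (T - algebraMap ℂ (E →L[ℂ] E) a)) {P : ℂ[X]} (hP : P ≠ 0) :
    DenseRange (aeval T P) := by
  have hlin : ∀ s : Multiset ℂ,
      DenseRange (aeval T (s.map fun a => X - C a).prod) := by
    intro s
    induction s using Multiset.induction with
    | empty => simpa using denseRange_id
    | cons a s ih =>
      rw [Multiset.map_cons, Multiset.prod_cons, map_mul, FunLike.coe_mul_eq_comp]
      refine DenseRange.comp ?_ ih (ContinuousLinearMap.continuous _)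
      simpa using hT a
  rw [(IsAlgClosed.splits P).eq_prod_roots, map_mul, FunLike.coe_mul_eq_comp]
  refine DenseRange.comp ?_ (hlin _) (ContinuousLinearMap.continuous _)
  refine Function.Surjective.denseRange fun y => ⟨P.leadingCoeff⁻¹ • y, ?_⟩
  rw [aeval_C, Algebra.algebraMap_eq_smul_one]
  simp [smul_smul, hP]

/-- If every `T - a` has dense range, then a single cyclic vector `x` yields a dense set of them:
every `P(T) x` with `P ≠ 0` is again cyclic, because `P(T)` has dense range and commutes with `T`. -/
theorem dense_setOf_cyclic_vector [Nontrivial E] {T : E →L[ℂ] E}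
    (hT : ∀ a : ℂ, DenseRange (T - algebraMap ℂ (E →L[ℂ] E) a))
    (hcyc : IsCyclicOperator T) :
    Dense {x : E | DenseRange fun P : ℂ[X] => aeval T P x} := by
  obtain ⟨x, hx⟩ := hcyc
  rw [span_orbit_eq_range_aeval] at hx
  have hx0 : Dense (range (fun P : ℂ[X] => aeval T P x) \ {0}) := hx.sdiff_singleton 0
  refine hx0.mono ?_
  rintro _ ⟨⟨P, rfl⟩, hne⟩
  have hP : P ≠ 0 := by
    rintro rfl
    simp at hne
  have hcomm : (fun Q : ℂ[X] => aeval T Q (aeval T P x))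
      = aeval T P ∘ fun Q : ℂ[X] => aeval T Q x := by
    funext Q
    simp only [Function.comp, ← mul_apply_eq_comp, ← map_mul, mul_comm]
  rw [mem_ofPred_eq, hcomm]
  exact (denseRange_aeval hT hP).comp hx (ContinuousLinearMap.continuous _)

/-- `T - a` is a left factor of `T ^ q - a ^ q`. -/
theorem denseRange_sub_algebraMap_of_pow {T : E →L[ℂ] E} {q : ℕ} (a : ℂ)
    (h : DenseRange (T ^ q - algebraMap ℂ (E →L[ℂ] E) (a ^ q))) :
    DenseRange (T - algebraMap ℂ (E →L[ℂ] E) a) := by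
  rw [map_pow, ← (Algebra.commute_algebraMap_right a T).mul_geom_sum₂ q,
    FunLike.coe_mul_eq_comp] at h
  exact h.mono (range_comp_subset_range _ _)

theorem continuous_aeval_apply {A : Type*} [TopologicalSpace A] {T : A → E →L[ℂ] E}
    (hT : Continuous fun z : E × A => T z.2 z.1) (P : ℂ[X]) (x : E) :
    Continuous fun a => aeval (T a) P x := by
  have hpow : ∀ n : ℕ, Continuous fun a => (T a ^ n) x := by
    intro n
    induction n with
    | zero => simpa using continuous_const
    | succ n ih =>
      simp only [pow_succ', mul_apply_eq_comp]
      exact hT.comp (ih.prodMk continuous_id)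
  induction P using Polynomial.induction_on' with
  | add P Q hP hQ => simpa using hP.fun_add hQ
  | monomial n c =>
    have := (hpow n).fun_const_smul c
    simpa [aeval_monomial, Algebra.algebraMap_eq_smul_one] using this

theorem continuous_comp_parameter {A B : Type*} [TopologicalSpace A] [TopologicalSpace B]
    {T : B → E →L[ℂ] E} (hT : Continuous fun z : E × B => T z.2 z.1) {c : A → B}
    (hc : Continuous c) : Continuous fun z : E × A => T (c z.2) z.1 :=
  hT.comp (continuous_fst.prodMk (hc.comp continuous_snd))

/-- Baire category argument: for a strongly continuous family of operators on a separable Banach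
space, cyclicity holds for generic parameters as soon as, for a dense set of parameters, the
vectors that are cyclic are dense. -/
theorem residual_isCyclicOperator {A : Type*} [TopologicalSpace A] [CompleteSpace E]
    [SecondCountableTopology E] {T : A → E →L[ℂ] E}
    (hT : Continuous fun z : E × A => T z.2 z.1)
    (hdense : Dense {a | Dense {x : E | DenseRange fun P : ℂ[X] => aeval (T a) P x}}) :
    {a | IsCyclicOperator (T a)} ∈ residual A := by
  set B := TopologicalSpace.countableBasis E
  have hB := TopologicalSpace.isBasis_countableBasis E
  have hBc : B.Countable := TopologicalSpace.countable_countableBasis E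
  have hBo : ∀ W ∈ B, IsOpen W := fun W hW => hB.isOpen hW
  have hBne : ∀ W ∈ B, W.Nonempty := fun W hW => TopologicalSpace.nonempty_of_mem_countableBasis hW
  -- the parameters for which some orbit span of a vector in `W` meets `V`: an open dense set
  let D : Set E → Set E → Set A := fun W V => {a | ∃ x ∈ W, ∃ P : ℂ[X], aeval (T a) P x ∈ V}
  have hD : ⋂ W ∈ B, ⋂ V ∈ B, D W V ∈ residual A := by
    refine (countable_bInter_mem hBc).2 fun W hW => (countable_bInter_mem hBc).2 fun V hV => ?_
    apply residual_of_dense_open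
    · have : D W V = ⋃ x ∈ W, ⋃ P : ℂ[X], (fun a => aeval (T a) P x) ⁻¹' V := by
        ext a; simp [D]
      rw [this]
      exact isOpen_biUnion fun x _ => isOpen_iUnion fun P =>
        (hBo V hV).preimage (continuous_aeval_apply hT P x)
    · refine hdense.mono fun a ha => ?_
      obtain ⟨x, hxW, hx⟩ := ha.exists_mem_open (hBo W hW) (hBne W hW)
      obtain ⟨P, hP⟩ := DenseRange.exists_mem_open hxW (hBo V hV) (hBne V hV)
      exact ⟨x, hx, P, hP⟩
  refine Filter.mem_of_superset hD fun a ha => ?_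
  simp only [mem_iInter] at ha
  -- a second application of Baire's theorem, in `E`: generic vectors have orbit spans that meet
  -- every basic open set
  have hgood : Dense (⋂ V ∈ B, {x : E | ∃ P : ℂ[X], aeval (T a) P x ∈ V}) := by
    refine dense_biInter_of_isOpen (fun V hV => ?_) hBc fun V hV => ?_
    · simp only [ofPred_exists]
      exact isOpen_iUnion fun P => (hBo V hV).preimage (ContinuousLinearMap.continuous _)
    · exact hB.dense_iff.2 fun W hW _ => ha W hW V hV
  obtain ⟨x, hx⟩ := hgood.nonempty
  simp only [mem_iInter] at hx
  refine ⟨x, ?_⟩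
  rw [span_orbit_eq_range_aeval]
  refine hB.dense_iff.2 fun V hV _ => ?_
  obtain ⟨P, hP⟩ := hx V hV
  exact ⟨_, hP, P, rfl⟩

end Operator

/-! ### Operators on `L^p([0, 1])` acting by multiplication -/

section Multiplication

open Filter Topology

instance isFiniteMeasure_lebesgue01 : IsFiniteMeasure lebesgue01 :=
  inferInstanceAs (IsFiniteMeasure (volume.restrict (Icc (0 : ℝ) 1)))

instance nullSingletonClass_lebesgue01 : NullSingletonClass lebesgue01 :=
  inferInstanceAs (NullSingletonClass (volume.restrict (Icc (0 : ℝ) 1)))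

variable {p : ℝ≥0∞} [Fact (1 ≤ p)]

/-- Dominated convergence in `L^p`. The pointwise statements concern chosen representatives `F i`
of the classes `f i`, because for an uncountable index set the exceptional null sets of `f i` can
not be discarded simultaneously. -/
theorem tendsto_Lp_of_dominated {Ω ι : Type*} [MeasurableSpace Ω] {μ : Measure Ω}
    (hp : p ≠ ∞) {l : Filter ι} [l.IsCountablyGenerated]
    {f : ι → Lp ℂ p μ} {F : ι → Ω → ℂ} {g : Lp ℂ p μ} {b : Ω → ℂ} (hb : MemLp b p μ)
    (hfF : ∀ i, f i =ᵐ[μ] F i) (hF : ∀ i, ∀ᵐ x ∂μ, ‖F i x‖ ≤ ‖b x‖)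
    (hg : ∀ᵐ x ∂μ, ‖g x‖ ≤ ‖b x‖)
    (hlim : ∀ᵐ x ∂μ, Tendsto (fun i => F i x) l (𝓝 (g x))) : Tendsto f l (𝓝 g) := by
  have hp0 : p ≠ 0 := (one_pos.trans_le (Fact.out : 1 ≤ p)).ne'
  have hp' : 0 < p.toReal := ENNReal.toReal_pos hp0 hp
  have heq : ∀ i, eLpNorm (f i - g : Ω → ℂ) p μ = eLpNorm (F i - ⇑g) p μ := fun i =>
    eLpNorm_congr_ae ((hfF i).sub (ae_eq_refl _))
  rw [Lp.tendsto_Lp_iff_tendsto_eLpNorm']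
  simp only [heq, eLpNorm_eq_lintegral_rpow_enorm_toReal hp0 hp]
  have hfin : ∫⁻ x, (2 * ‖b x‖ₑ) ^ p.toReal ∂μ ≠ ∞ := by
    have h2 := (hb.const_mul (2 : ℂ)).2
    rw [eLpNorm_lt_top_iff_lintegral_rpow_enorm_lt_top hp0 hp] at h2
    refine ne_of_lt (lt_of_le_of_lt (le_of_eq ?_) h2)
    refine lintegral_congr fun x => ?_
    have : ‖(2 : ℂ)‖ₑ = 2 := by
      rw [← ofReal_norm]; simp
    simp [enorm_mul, this]
  have key : Tendsto (fun i => ∫⁻ x, ‖(F i - ⇑g) x‖ₑ ^ p.toReal ∂μ) l (𝓝 0) := by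
    have := tendsto_lintegral_filter_of_dominated_convergence'
      (μ := μ) (l := l) (F := fun i x => ‖(F i - ⇑g) x‖ₑ ^ p.toReal) (f := fun _ => 0)
      (fun x => (2 * ‖b x‖ₑ) ^ p.toReal)
      (Eventually.of_forall fun i =>
        ((((Lp.aestronglyMeasurable (f i)).congr (hfF i)).sub
          (Lp.aestronglyMeasurable g)).enorm.pow_const _)) (Eventually.of_forall fun i => ?_)
      hfin ?_
    · simpa using this
    · filter_upwards [hF i, hg] with x h1 h2
      gcongr
      rw [Pi.sub_apply, two_mul]
      exact enorm_sub_le.trans (add_le_add (enorm_le_iff_norm_le.2 h1) (enorm_le_iff_norm_le.2 h2))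
    · filter_upwards [hlim] with x hx
      have h1 : Tendsto (fun i => F i x - g x) l (𝓝 0) := by simpa using hx.sub_const (g x)
      have h2 := (ENNReal.continuous_rpow_const (y := p.toReal)).tendsto 0 |>.comp
        (by simpa using h1.enorm)
      simpa [Function.comp_def, ENNReal.zero_rpow_of_pos hp'] using h2
  have := (ENNReal.continuous_rpow_const (y := 1 / p.toReal)).tendsto 0 |>.comp key
  rwa [ENNReal.zero_rpow_of_pos (by positivity)] at this

theorem multiplicationOp_ae_eq (ψ : Lp ℂ ∞ lebesgue01) (f : Lp ℂ p lebesgue01) :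
    multiplicationOp p ψ f =ᵐ[lebesgue01] fun x => ψ x * f x := by
  filter_upwards [(ContinuousLinearMap.mul ℂ ℂ).coeFn_holder (r := p) ψ f] with x hx
  simpa [multiplicationOp] using hx

/-- The multiplication by the indicator function of `E`, a projection onto the subspace of
functions vanishing off `E`. -/
noncomputable def cutoff (p : ℝ≥0∞) [Fact (1 ≤ p)] {E : Set ℝ} (hE : MeasurableSet E) :
    Lp ℂ p lebesgue01 →L[ℂ] Lp ℂ p lebesgue01 :=
  multiplicationOp p (indicatorConstLp ∞ hE (measure_ne_top lebesgue01 E) 1)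

theorem cutoff_ae_eq {E : Set ℝ} (hE : MeasurableSet E) (f : Lp ℂ p lebesgue01) :
    cutoff p hE f =ᵐ[lebesgue01] E.indicator f := by
  filter_upwards [multiplicationOp_ae_eq (indicatorConstLp ∞ hE (measure_ne_top lebesgue01 E) 1) f,
    indicatorConstLp_coeFn (p := ∞) (hs := hE) (hμs := measure_ne_top lebesgue01 E) (c := (1 : ℂ))]
    with x h1 h2
  rw [cutoff, h1, h2]
  by_cases hx : x ∈ E <;> simp [hx]

/-- An operator acting as multiplication by an a.e. nonzero function has dense range: `g` is the
limit of the cutoffs of `g` to the sets `{|m| ≥ 1/n}`, which lie in the range. -/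
theorem denseRange_of_ae_eq_mul (hp : p ≠ ∞) {S : Lp ℂ p lebesgue01 →L[ℂ] Lp ℂ p lebesgue01}
    {m : ℝ → ℂ} (hm : Measurable m) (hm0 : ∀ᵐ x ∂lebesgue01, m x ≠ 0)
    (hS : ∀ f, S f =ᵐ[lebesgue01] fun x => m x * f x) : DenseRange S := by
  intro g
  let E : ℕ → Set ℝ := fun n => {x | 1 ≤ n * ‖m x‖}
  have hE : ∀ n, MeasurableSet (E n) := fun n =>
    measurableSet_le measurable_const (measurable_const.mul hm.norm)
  have hh : ∀ n, MemLp ((E n).indicator fun x => g x / m x) p lebesgue01 := by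
    intro n
    refine (Lp.memLp g).of_le_mul (c := n) (((Lp.stronglyMeasurable g).measurable.div
      hm).indicator (hE n)).aestronglyMeasurable (Eventually.of_forall fun x => ?_)
    by_cases hx : x ∈ E n
    · have hx' : 1 ≤ n * ‖m x‖ := hx
      have hpos : 0 < ‖m x‖ := by
        by_contra h
        have : ‖m x‖ = 0 := le_antisymm (not_lt.1 h) (norm_nonneg _)
        rw [this] at hx'
        norm_num at hx'
      rw [indicator_of_mem hx, norm_div, div_le_iff₀ hpos]
      nlinarith [norm_nonneg (g x)]
    · rw [indicator_of_notMem hx, norm_zero]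
      positivity
  have hSh : ∀ n, S ((hh n).toLp _) =ᵐ[lebesgue01] (E n).indicator g := by
    intro n
    filter_upwards [hS ((hh n).toLp _), (hh n).coeFn_toLp, hm0] with x h1 h2 h3
    rw [h1, h2]
    by_cases hx : x ∈ E n
    · simp only [indicator_of_mem hx]
      field_simp
    · simp [hx]
  refine mem_closure_of_tendsto (b := atTop) (f := fun n => S ((hh n).toLp _))
    (tendsto_Lp_of_dominated hp (Lp.memLp g) hSh
      (fun n => Eventually.of_forall fun x => norm_indicator_le_norm_self _ _)
      (Eventually.of_forall fun _ => le_rfl) ?_) (Eventually.of_forall fun n => mem_range_self _)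
  · filter_upwards [hm0] with x h0
    obtain ⟨N, hN⟩ := exists_nat_ge (1 / ‖m x‖)
    refine tendsto_const_nhds.congr' ?_
    filter_upwards [eventually_ge_atTop N] with n hn
    have hmem : x ∈ E n := by
      have : 0 < ‖m x‖ := norm_pos_iff.2 h0
      rw [div_le_iff₀ this] at hN
      have hn' : (N : ℝ) ≤ n := by exact_mod_cast hn
      exact hN.trans (by gcongr)
    rw [indicator_of_mem hmem]

theorem aeval_ae_eq_mul {S : Lp ℂ p lebesgue01 →L[ℂ] Lp ℂ p lebesgue01} {m : ℝ → ℂ}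
    (hS : ∀ f, S f =ᵐ[lebesgue01] fun x => m x * f x) (P : Polynomial ℂ) (f : Lp ℂ p lebesgue01) :
    Polynomial.aeval S P f =ᵐ[lebesgue01] fun x => P.eval (m x) * f x := by
  have hpow : ∀ n : ℕ, (S ^ n) f =ᵐ[lebesgue01] fun x => m x ^ n * f x := by
    intro n
    induction n with
    | zero => simp
    | succ n ih =>
      rw [pow_succ', mul_apply_eq_comp]
      filter_upwards [hS ((S ^ n) f), ih] with x h1 h2
      rw [h1, h2]
      ring
  induction P using Polynomial.induction_on' with
  | add P Q hP hQ =>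
    rw [map_add, add_apply]
    filter_upwards [hP, hQ, Lp.coeFn_add (Polynomial.aeval S P f) (Polynomial.aeval S Q f)]
      with x h1 h2 h3
    rw [h3, Pi.add_apply, h1, h2, Polynomial.eval_add, add_mul]
  | monomial n c =>
    have : Polynomial.aeval S (Polynomial.monomial n c) f = c • (S ^ n) f := by
      rw [Polynomial.aeval_monomial, Algebra.algebraMap_eq_smul_one]
      simp
    rw [this]
    filter_upwards [Lp.coeFn_smul c ((S ^ n) f), hpow n] with x h1 h2
    rw [h1, Pi.smul_apply, h2, Polynomial.eval_monomial, smul_eq_mul, mul_assoc]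

end Multiplication

/-! ### Polynomial approximation in `L^p` -/

/-- Polynomials are dense in `L^p(ν)` for a finite measure `ν` carried by a bounded interval. -/
theorem exists_polynomial_eLpNorm_sub_le {p : ℝ≥0∞} (hp : p ≠ ∞) {ν : Measure ℝ}
    [IsFiniteMeasure ν] {a b : ℝ} (hν : ∀ᵐ x ∂ν, x ∈ Icc a b) {G : ℝ → ℂ} (hG : MemLp G p ν)
    (hp1 : 1 ≤ p) {ε : ℝ≥0∞} (hε : ε ≠ 0) :
    ∃ P : Polynomial ℂ, eLpNorm (fun x : ℝ => P.eval (x : ℂ) - G x) p ν ≤ ε := by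
  obtain ⟨g, hg, -⟩ := hG.exists_boundedContinuous_eLpNorm_sub_le hp
    (ENNReal.half_pos hε).ne'
  -- `δ` is such that a uniform error of `δ` costs at most `ε / 2` in `L^p(ν)`
  obtain ⟨δ, hδ, hδε⟩ : ∃ δ : ℝ, 0 < δ ∧
      ν univ ^ p.toReal⁻¹ * ENNReal.ofReal δ ≤ ε / 2 := by
    have hfin : ν univ ^ p.toReal⁻¹ ≠ ∞ :=
      ENNReal.rpow_ne_top_of_nonneg (by positivity) (measure_ne_top _ _)
    have hlim : Filter.Tendsto (fun δ : ℝ => ν univ ^ p.toReal⁻¹ * ENNReal.ofReal δ)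
        (nhdsWithin 0 (Ioi 0)) (nhds 0) := by
      have h1 : Filter.Tendsto ENNReal.ofReal (nhdsWithin 0 (Ioi 0)) (nhds 0) := by
        simpa using (ENNReal.continuous_ofReal.tendsto 0).mono_left nhdsWithin_le_nhds
      simpa using ENNReal.Tendsto.const_mul h1 (Or.inr hfin)
    have hev := hlim.eventually (ge_mem_nhds (ENNReal.half_pos hε))
    obtain ⟨δ, h1, h2⟩ := (hev.and self_mem_nhdsWithin).exists
    exact ⟨δ, h2, h1⟩
  obtain ⟨A, hA⟩ := exists_polynomial_near_of_continuousOn a b (fun x => (g x).re)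
    (by fun_prop) (δ / 2) (half_pos hδ)
  obtain ⟨B, hB⟩ := exists_polynomial_near_of_continuousOn a b (fun x => (g x).im)
    (by fun_prop) (δ / 2) (half_pos hδ)
  refine ⟨A.map Complex.ofRealHom + Polynomial.C Complex.I * B.map Complex.ofRealHom, ?_⟩
  set P := A.map Complex.ofRealHom + Polynomial.C Complex.I * B.map Complex.ofRealHom with hP
  have heval : ∀ x : ℝ, P.eval (x : ℂ) = ((A.eval x : ℝ) : ℂ) + Complex.I * ((B.eval x : ℝ) : ℂ) := by
    intro x
    have h : ∀ Q : Polynomial ℝ,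
        (Q.map Complex.ofRealHom).eval (x : ℂ) = ((Q.eval x : ℝ) : ℂ) := fun Q => by
      simpa using Polynomial.eval_map_apply (f := Complex.ofRealHom) (p := Q) x
    simp [hP, h]
  have h1 : eLpNorm (fun x : ℝ => P.eval (x : ℂ) - g x) p ν ≤ ε / 2 := by
    refine le_trans (eLpNorm_le_of_ae_bound (C := δ) ?_) hδε
    filter_upwards [hν] with x hx
    have hsplit : P.eval (x : ℂ) - g x = ((A.eval x - (g x).re : ℝ) : ℂ)
        + Complex.I * ((B.eval x - (g x).im : ℝ) : ℂ) := by
      rw [heval]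
      conv_lhs => rw [← Complex.re_add_im (g x)]
      push_cast
      ring
    rw [hsplit]
    refine (norm_add_le _ _).trans ?_
    rw [norm_mul, Complex.norm_I, one_mul, Complex.norm_real, Complex.norm_real]
    have := hA x hx
    have := hB x hx
    simp only [Real.norm_eq_abs]
    linarith
  have hcont : Continuous fun x : ℝ => P.eval (x : ℂ) :=
    P.continuous.comp Complex.continuous_ofReal
  have hdecomp : (fun x : ℝ => P.eval (x : ℂ) - G x)
      = (fun x : ℝ => P.eval (x : ℂ) - g x) - (G - ⇑g) := by
    funext x
    simp
  rw [hdecomp]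
  calc _ ≤ eLpNorm (fun x : ℝ => P.eval (x : ℂ) - g x) p ν + eLpNorm (G - ⇑g) p ν :=
        eLpNorm_sub_le (hcont.sub g.continuous).aestronglyMeasurable
          (hG.1.sub g.continuous.aestronglyMeasurable) hp1
    _ ≤ ε / 2 + ε / 2 := add_le_add h1 hg
    _ = ε := ENNReal.add_halves ε

/-- Polynomials in a bounded function `Φ` that is injective on `I` are dense in `L^p(I)`: pushing
forward by `Φ` reduces this to the density of polynomials in `L^p` of an interval. -/
theorem exists_polynomial_comp_eLpNorm_sub_le {p : ℝ≥0∞} (hp : p ≠ ∞) (hp1 : 1 ≤ p)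
    {μ : Measure ℝ} [IsFiniteMeasure μ] {I : Set ℝ} (hI : MeasurableSet I) {Φ : ℝ → ℝ}
    (hΦ : Measurable Φ) {a b : ℝ} (hab : ∀ x, Φ x ∈ Icc a b) (hinj : InjOn Φ I) {g : ℝ → ℂ}
    (hgm : Measurable g) (hg : MemLp g p μ) {ε : ℝ≥0∞} (hε : ε ≠ 0) :
    ∃ P : Polynomial ℂ,
      eLpNorm (fun x : ℝ => P.eval (Φ x : ℂ) - g x) p (μ.restrict I) ≤ ε := by
  have : StandardBorelSpace I := hI.standardBorel
  have hemb : MeasurableEmbedding (fun x : I => Φ x) :=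
    (hΦ.comp measurable_subtype_coe).measurableEmbedding fun x y hxy =>
      Subtype.ext (hinj x.2 y.2 hxy)
  obtain ⟨G, hGm, hG⟩ := hemb.exists_measurable_extend (g := fun x : I => g x)
    (hgm.comp measurable_subtype_coe) fun _ => ⟨0⟩
  have hGg : G ∘ Φ =ᵐ[μ.restrict I] g := by
    filter_upwards [ae_restrict_mem hI] with x hx
    exact congrFun hG ⟨x, hx⟩
  set ν := (μ.restrict I).map Φ with hν
  have hmem : MemLp G p ν := by
    rw [hν, memLp_map_measure_iff hGm.aestronglyMeasurable hΦ.aemeasurable]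
    exact (memLp_congr_ae hGg).2 (hg.restrict I)
  obtain ⟨P, hP⟩ := exists_polynomial_eLpNorm_sub_le hp (a := a) (b := b) (ν := ν)
    ((ae_map_iff hΦ.aemeasurable measurableSet_Icc).2 (Filter.Eventually.of_forall hab)) hmem hp1 hε
  refine ⟨P, le_trans (le_of_eq ?_) hP⟩
  have hcont : Continuous fun x : ℝ => P.eval (x : ℂ) :=
    P.continuous.comp Complex.continuous_ofReal
  have hmeas : Measurable fun x : ℝ => P.eval (x : ℂ) - G x := hcont.measurable.sub hGm
  rw [hν, eLpNorm_map_measure hmeas.aestronglyMeasurable hΦ.aemeasurable]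
  refine eLpNorm_congr_ae ?_
  filter_upwards [hGg] with x hx
  simp only [Function.comp] at hx ⊢
  rw [hx]

/-! ### Continuous dependence on the translation parameter -/

section Translation

open Filter Topology

variable {p : ℝ≥0∞} [Fact (1 ≤ p)]

theorem ae_fract_add_ne_zero (α : ℝ) : ∀ᵐ x ∂lebesgue01, Int.fract (x + α) ≠ 0 := by
  have hc : (range fun n : ℤ => (n : ℝ) - α).Countable := countable_range _
  filter_upwards [hc.ae_notMem lebesgue01] with x hx h0
  refine hx ⟨⌊x + α⌋, ?_⟩
  have := Int.self_sub_floor (x + α)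
  simp only
  linarith

theorem ae_fract_eq_self : ∀ᵐ x ∂lebesgue01, Int.fract x = x := by
  have h1 : ∀ᵐ x ∂lebesgue01, x ≠ 1 := (countable_singleton (1 : ℝ)).ae_notMem lebesgue01
  have h2 : ∀ᵐ x ∂lebesgue01, x ∈ Icc (0 : ℝ) 1 := ae_restrict_mem measurableSet_Icc
  filter_upwards [h1, h2] with x hx1 hx2
  exact Int.fract_eq_self.2 ⟨hx2.1, lt_of_le_of_ne hx2.2 hx1⟩

theorem translationOp_ae_eq (α : ℝ) (f : Lp ℂ p lebesgue01) :
    translationOp p α f =ᵐ[lebesgue01] fun x => f (Int.fract (x + α)) :=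
  Lp.coeFn_compMeasurePreserving f (measurePreserving_fract_add α)

/-- Translations are isometries, so it suffices to check continuity in `α` on the dense set of bounded
continuous functions, where dominated convergence applies off the jump of the fractional part. -/
theorem continuous_translationOp (hp : p ≠ ∞) :
    Continuous fun z : Lp ℂ p lebesgue01 × ℝ => translationOp p z.2 z.1 := by
  refine continuous_prod_of_dense_continuous_lipschitzWith _ 1
    (BoundedContinuousFunction.toLp_denseRange ℂ lebesgue01 ℂ hp) ?_ fun α =>
      (Lp.compMeasurePreservingₗᵢ ℂ (fun x : ℝ => Int.fract (x + α))
        (measurePreserving_fract_add α)).isometry.lipschitz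
  rintro _ ⟨u, rfl⟩
  have hu : ∀ α : ℝ, translationOp p α (BoundedContinuousFunction.toLp p lebesgue01 ℂ u)
      =ᵐ[lebesgue01] fun x => u (Int.fract (x + α)) := by
    intro α
    filter_upwards [translationOp_ae_eq α (BoundedContinuousFunction.toLp p lebesgue01 ℂ u),
      (measurePreserving_fract_add α).quasiMeasurePreserving.ae
        (BoundedContinuousFunction.coeFn_toLp p lebesgue01 ℂ u)] with x h1 h2
    rw [h1, h2]
  have hbound : ∀ y, ‖u y‖ ≤ ‖((‖u‖ : ℝ) : ℂ)‖ := by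
    intro y
    rw [Complex.norm_real, norm_norm]
    exact u.norm_coe_le_norm y
  refine continuous_iff_continuousAt.2 fun α₀ => ?_
  refine tendsto_Lp_of_dominated hp (memLp_const ((‖u‖ : ℝ) : ℂ)) hu
    (fun α => Eventually.of_forall fun x => hbound _) ?_ ?_
  · filter_upwards [hu α₀] with x hx
    rw [hx]
    exact hbound _
  · filter_upwards [hu α₀, ae_fract_add_ne_zero α₀] with x hx hne
    rw [hx]
    have hfl : x + α₀ ≠ ⌊x + α₀⌋ := fun h => hne (by rw [Int.fract, ← h, sub_self])
    exact (u.continuous.tendsto _).comp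
      ((continuousAt_fract hfl).tendsto.comp ((continuous_const_add x).tendsto α₀))

end Translation

theorem continuous_weightedTranslation {p : ℝ≥0∞} [Fact (1 ≤ p)] (hp : p ≠ ∞)
    (ψ : Lp ℂ ∞ lebesgue01) :
    Continuous fun z : Lp ℂ p lebesgue01 × ℝ => weightedTranslation p ψ z.2 z.1 :=
  (multiplicationOp p ψ).continuous.comp (continuous_translationOp hp)

/-! ### Rational rotations -/

theorem fract_fract_add (x y : ℝ) : Int.fract (Int.fract x + y) = Int.fract (x + y) := by
  rw [Int.fract_eq_fract]
  exact ⟨-⌊x⌋, by rw [Int.fract]; push_cast; ring⟩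

/-- In terms of the cells `[k / q, (k + 1) / q)`: a translation by `m / q` modulo `1` permutes them
and preserves the position `{q x} / q` inside the cell. -/
theorem fract_add_div (x : ℝ) (m : ℤ) {q : ℕ} (hq : 0 < q) :
    Int.fract (x + m / q) = (Int.fract (q * x) + ((⌊q * x⌋ + m) % q : ℤ)) / q := by
  have hq' : (0 : ℝ) < q := by exact_mod_cast hq
  have hqz : (q : ℤ) ≠ 0 := by exact_mod_cast hq.ne'
  have h0 := Int.emod_nonneg (⌊q * x⌋ + m) hqz
  have h1 := Int.emod_lt_of_pos (⌊q * x⌋ + m) (by exact_mod_cast hq : (0 : ℤ) < q)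
  have h1' : (((⌊q * x⌋ + m) % q : ℤ) : ℝ) + 1 ≤ q := by exact_mod_cast h1
  have h0' : (0 : ℝ) ≤ ((⌊q * x⌋ + m) % q : ℤ) := by exact_mod_cast h0
  rw [Int.fract_eq_iff]
  refine ⟨div_nonneg (add_nonneg (Int.fract_nonneg _) h0') hq'.le, ?_, (⌊q * x⌋ + m) / q, ?_⟩
  · rw [div_lt_one hq']
    linarith [Int.fract_lt_one (q * x)]
  · have h2 : ((q : ℤ) : ℝ) * ((⌊q * x⌋ + m) / q : ℤ) + ((⌊q * x⌋ + m) % q : ℤ)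
        = (⌊q * x⌋ + m : ℤ) := by
      exact_mod_cast Int.mul_ediv_add_emod _ _
    have h3 := Int.self_sub_floor (q * x)
    push_cast at h2
    have h4 : x + m / q - (Int.fract (q * x) + ((⌊q * x⌋ + m) % q : ℤ)) / q
        = (q * x + m - (Int.fract (q * x) + ((⌊q * x⌋ + m) % q : ℤ))) / q := by
      rw [sub_div _ _ (q : ℝ), add_div (q * x), mul_div_cancel_left₀ _ hq'.ne']
    rw [h4, div_eq_iff hq'.ne']
    linarith

/-- The rotation by `r / q`, with `r` and `q` coprime, moves every point off the grid
`ℤ / q` into the first cell `(0, 1 / q)` after fewer than `q` steps. -/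
theorem exists_fract_add_mul_mem_Ioo {r : ℤ} {q : ℕ} (hq : 0 < q) (hrq : IsCoprime r (q : ℤ))
    {x : ℝ} (hx : Int.fract (q * x) ≠ 0) :
    ∃ i < q, Int.fract (x + i * (r / q)) ∈ Ioo (0 : ℝ) (1 / q) := by
  obtain ⟨u, v, huv⟩ := hrq
  have hqz : (0 : ℤ) < q := by exact_mod_cast hq
  have hq' : (0 : ℝ) < q := by exact_mod_cast hq
  set k := ⌊q * x⌋
  -- `u` inverts `r` modulo `q`, so the number of steps is `-k * u` modulo `q`
  have hi0 := Int.emod_nonneg (-k * u) hqz.ne'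
  have hi1 := Int.emod_lt_of_pos (-k * u) hqz
  refine ⟨((-k * u) % q).toNat, by omega, ?_⟩
  have hcast : ((((-k * u) % q).toNat : ℕ) : ℝ) = ((-k * u) % q : ℤ) := by
    exact_mod_cast Int.toNat_of_nonneg hi0
  have hdvd : (k + ((-k * u) % q) * r) % q = 0 := by
    apply Int.emod_eq_zero_of_dvd
    have h1 := Int.mul_ediv_add_emod (-k * u) q
    refine ⟨k * v - ((-k * u) / q) * r, ?_⟩
    linear_combination r * h1 - k * huv
  have heq : x + ((((-k * u) % q).toNat : ℕ) : ℝ) * (r / q)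
      = x + (((-k * u) % q * r : ℤ) : ℝ) / q := by
    rw [hcast]; push_cast; ring
  rw [heq, fract_add_div x _ hq, hdvd]
  have hpos : 0 < Int.fract (q * x) := lt_of_le_of_ne (Int.fract_nonneg _) (Ne.symm hx)
  simp only [Int.cast_zero, add_zero]
  exact ⟨by positivity, by gcongr; exact Int.fract_lt_one _⟩

/-- The product `φ(x) φ({x + α}) ⋯ φ({x + (n - 1) α})`, by which the `n`-th power of the weighted
translation multiplies. The leading factor is written `φ({x})`, so that the product is
`1`-periodic in `x`. -/
noncomputable def weightCocycle (φ : ℝ → ℝ) (α : ℝ) (n : ℕ) (x : ℝ) : ℝ :=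
  ∏ i ∈ Finset.range n, φ (Int.fract (x + i * α))

section Cocycle

variable {φ : ℝ → ℝ}

theorem fract_mem_Icc (x : ℝ) : Int.fract x ∈ Icc (0 : ℝ) 1 :=
  ⟨Int.fract_nonneg x, (Int.fract_lt_one x).le⟩

theorem measurable_weightCocycle (hφ : ContinuousOn φ (Icc 0 1)) (α : ℝ) (n : ℕ) :
    Measurable (weightCocycle φ α n) := by
  refine Finset.measurable_prod _ fun i _ => ?_
  have hext : (fun x => φ (Int.fract (x + i * α)))
      = fun x => IccExtend zero_le_one ((Icc (0 : ℝ) 1).domRestrict φ)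
          (Int.fract (x + i * α)) := by
    funext x
    rw [IccExtend_of_mem _ _ (fract_mem_Icc _)]
    rfl
  -- `φ` is arbitrary off `[0, 1]`, but only its continuous restriction to `[0, 1]` matters
  rw [hext]
  exact (continuous_IccExtend_iff.2 (continuousOn_iff_continuous_domRestrict.1 hφ)).measurable.comp
    (measurable_id.add_const _).fract

theorem weightCocycle_mem_Icc (hincr : StrictMonoOn φ (Icc 0 1)) (h0 : φ 0 = 0) (α : ℝ) (n : ℕ)
    (x : ℝ) : weightCocycle φ α n x ∈ Icc 0 (φ 1 ^ n) := by
  have hnn : ∀ i ∈ Finset.range n, 0 ≤ φ (Int.fract (x + i * α)) := fun i _ => by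
    rw [← h0]
    exact hincr.monotoneOn ⟨le_rfl, zero_le_one⟩ (fract_mem_Icc _) (fract_mem_Icc _).1
  refine ⟨Finset.prod_nonneg hnn, ?_⟩
  refine (Finset.prod_le_prod hnn fun i _ => hincr.monotoneOn (fract_mem_Icc _)
    ⟨zero_le_one, le_rfl⟩ (fract_mem_Icc _).2).trans_eq ?_
  simp

/-- On a cell `(k / q, (k + 1) / q)` each of the `q` factors is positive and strictly increasing. The
left end point of the cell is excluded: there one of the factors is `φ 0 = 0`. -/
theorem weightCocycle_lt {q : ℕ} (hq : 0 < q) (r : ℤ) (hincr : StrictMonoOn φ (Icc 0 1))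
    (h0 : φ 0 = 0) {x y : ℝ} (hxy : x < y) (hfloor : ⌊q * x⌋ = ⌊q * y⌋)
    (hx : Int.fract (q * x) ≠ 0) :
    weightCocycle φ (r / q) q x < weightCocycle φ (r / q) q y := by
  have hq' : (0 : ℝ) < q := by exact_mod_cast hq
  have hform : ∀ (z : ℝ) (i : ℕ), Int.fract (z + i * (r / q))
      = (Int.fract (q * z) + ((⌊q * z⌋ + i * r) % q : ℤ)) / q := by
    intro z i
    rw [← fract_add_div z _ hq]
    push_cast
    congr 1
    ring
  refine Finset.prod_lt_prod_of_nonempty (fun i _ => ?_) (fun i _ => ?_) (by simpa using hq.ne')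
  · have hpos : 0 < Int.fract (q * x) := lt_of_le_of_ne (Int.fract_nonneg _) (Ne.symm hx)
    have hnn : (0 : ℝ) ≤ ((⌊q * x⌋ + i * r) % q : ℤ) := by
      exact_mod_cast Int.emod_nonneg _ (by exact_mod_cast hq.ne')
    rw [← h0]
    refine hincr ⟨le_rfl, zero_le_one⟩ (fract_mem_Icc _) ?_
    rw [hform]
    positivity
  · refine hincr (fract_mem_Icc _) (fract_mem_Icc _) ?_
    rw [hform, hform, hfloor]
    gcongr
    rw [Int.fract, Int.fract, hfloor]
    gcongr

theorem injOn_weightCocycle {q : ℕ} (hq : 0 < q) (r : ℤ) (hincr : StrictMonoOn φ (Icc 0 1))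
    (h0 : φ 0 = 0) (k : ℤ) :
    InjOn (weightCocycle φ (r / q) q) {x | ⌊q * x⌋ = k ∧ Int.fract (q * x) ≠ 0} := by
  rintro x ⟨hx, hx'⟩ y ⟨hy, hy'⟩ hxy
  rcases lt_trichotomy x y with h | h | h
  · exact absurd hxy (weightCocycle_lt hq r hincr h0 h (hx.trans hy.symm) hx').ne
  · exact h
  · exact absurd hxy (weightCocycle_lt hq r hincr h0 h (hy.trans hx.symm) hy').ne'

theorem ae_fract_natCast_mul_ne_zero {q : ℕ} (hq : 0 < q) :
    ∀ᵐ x ∂lebesgue01, Int.fract ((q : ℝ) * x) ≠ 0 := by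
  have hq' : (q : ℝ) ≠ 0 := by exact_mod_cast hq.ne'
  have hc : (range fun n : ℤ => (n : ℝ) / q).Countable := countable_range _
  filter_upwards [hc.ae_notMem lebesgue01] with x hx h0
  refine hx ⟨⌊q * x⌋, ?_⟩
  have := Int.self_sub_floor (q * x)
  simp only
  field_simp
  linarith

/-- The level sets of the full product along a rational rotation are null. -/
theorem ae_weightCocycle_ne {q : ℕ} (hq : 0 < q) (r : ℤ) (hincr : StrictMonoOn φ (Icc 0 1))
    (h0 : φ 0 = 0) (c : ℂ) : ∀ᵐ x ∂lebesgue01, (weightCocycle φ (r / q) q x : ℂ) ≠ c := by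
  have hcount : (⋃ k : ℤ, {x : ℝ | ⌊q * x⌋ = k ∧ Int.fract (q * x) ≠ 0} ∩
      {x | weightCocycle φ (r / q) q x = c.re}).Countable := by
    refine countable_iUnion fun k => Subsingleton.countable ?_
    rintro x ⟨hx, hx'⟩ y ⟨hy, hy'⟩
    exact injOn_weightCocycle hq r hincr h0 k hx hy (Eq.trans hx' (Eq.symm hy'))
  filter_upwards [hcount.ae_notMem lebesgue01, ae_fract_natCast_mul_ne_zero hq] with x hx hx' hc
  refine hx (mem_iUnion.2 ⟨⌊q * x⌋, ⟨rfl, hx'⟩, ?_⟩)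
  simp [← hc]

end Cocycle

section Power

variable {p : ℝ≥0∞} [Fact (1 ≤ p)] {φ : ℝ → ℝ}

theorem weightedTranslation_weight_ae_eq (hφ : ContinuousOn φ (Icc 0 1)) (α : ℝ)
    (f : Lp ℂ p lebesgue01) :
    weightedTranslation p (weightOfContinuousOn φ hφ) α f
      =ᵐ[lebesgue01] fun x => (φ (Int.fract x) : ℂ) * f (Int.fract (x + α)) := by
  filter_upwards [weightedTranslation_ae_eq p (weightOfContinuousOn φ hφ) α f,
    (memLp_top_of_continuousOn hφ).coeFn_toLp, ae_fract_eq_self] with x h1 h2 h3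
  rw [h1, weightOfContinuousOn, h2, h3]

theorem weightedTranslation_pow_ae_eq (hφ : ContinuousOn φ (Icc 0 1)) (α : ℝ) (n : ℕ)
    (f : Lp ℂ p lebesgue01) :
    (weightedTranslation p (weightOfContinuousOn φ hφ) α ^ n) f
      =ᵐ[lebesgue01] fun x => (weightCocycle φ α n x : ℂ) * f (Int.fract (x + n * α)) := by
  induction n with
  | zero =>
    filter_upwards [ae_fract_eq_self] with x hx
    simp [weightCocycle, hx]
  | succ n ih =>
    rw [pow_succ', mul_apply_eq_comp]
    filter_upwards [weightedTranslation_weight_ae_eq hφ α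
      ((weightedTranslation p (weightOfContinuousOn φ hφ) α ^ n) f),
      (measurePreserving_fract_add α).quasiMeasurePreserving.ae ih] with x h1 h2
    have hshift : ∀ i : ℕ,
        Int.fract (Int.fract (x + α) + i * α) = Int.fract (x + (i + 1 : ℕ) * α) := by
      intro i
      rw [fract_fract_add]
      push_cast
      congr 1
      ring
    rw [h1, h2, hshift, weightCocycle, weightCocycle, Finset.prod_range_succ']
    simp only [hshift]
    push_cast
    simp
    ring

theorem weightedTranslation_pow_period_ae_eq (hφ : ContinuousOn φ (Icc 0 1)) {q : ℕ} (hq : 0 < q)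
    (r : ℤ) (f : Lp ℂ p lebesgue01) :
    (weightedTranslation p (weightOfContinuousOn φ hφ) (r / q) ^ q) f
      =ᵐ[lebesgue01] fun x => (weightCocycle φ (r / q) q x : ℂ) * f x := by
  have hq' : (q : ℝ) ≠ 0 := by exact_mod_cast hq.ne'
  filter_upwards [weightedTranslation_pow_ae_eq hφ (r / q) q f, ae_fract_eq_self] with x h1 h2
  rw [h1, mul_div_cancel₀ _ hq', Int.fract_add_intCast, h2]

end Power

/-! ### Cyclicity for rational rotations -/

section Rational

variable {p : ℝ≥0∞} [Fact (1 ≤ p)] {φ : ℝ → ℝ}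

theorem measurable_fract_add (α : ℝ) : Measurable fun x : ℝ => Int.fract (x + α) :=
  (measurePreserving_fract_add α).measurable

/-- The weighted translation carries functions supported in `E` to functions supported in the
preimage of `E` under the rotation. -/
theorem cutoff_preimage_comp (hφ : ContinuousOn φ (Icc 0 1)) (α : ℝ) {E : Set ℝ}
    (hE : MeasurableSet E) (f : Lp ℂ p lebesgue01) :
    cutoff p (measurable_fract_add α hE) (weightedTranslation p (weightOfContinuousOn φ hφ) α f)
      = weightedTranslation p (weightOfContinuousOn φ hφ) α (cutoff p hE f) := by
  refine Lp.ext ?_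
  filter_upwards [cutoff_ae_eq (measurable_fract_add α hE)
      (weightedTranslation p (weightOfContinuousOn φ hφ) α f),
    weightedTranslation_weight_ae_eq hφ α f,
    weightedTranslation_weight_ae_eq hφ α (cutoff p hE f),
    (measurePreserving_fract_add α).quasiMeasurePreserving.ae (cutoff_ae_eq hE f)]
    with x h1 h2 h3 h4
  rw [h1, h3, h4]
  by_cases hx : Int.fract (x + α) ∈ E
  · rw [indicator_of_mem (show x ∈ (fun x : ℝ => Int.fract (x + α)) ⁻¹' E from hx), h2,
      indicator_of_mem hx]
  · rw [indicator_of_notMem (show x ∉ (fun x : ℝ => Int.fract (x + α)) ⁻¹' E from hx),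
      indicator_of_notMem hx, mul_zero]

theorem cutoff_congr {E E' : Set ℝ} (hE : MeasurableSet E) (hE' : MeasurableSet E')
    (h : ∀ᵐ x ∂lebesgue01, x ∈ E ↔ x ∈ E') (f : Lp ℂ p lebesgue01) :
    cutoff p hE f = cutoff p hE' f := by
  refine Lp.ext ?_
  filter_upwards [cutoff_ae_eq hE f, cutoff_ae_eq hE' f, h] with x h1 h2 h3
  rw [h1, h2]
  by_cases hx : x ∈ E
  · rw [indicator_of_mem hx, indicator_of_mem (h3.1 hx)]
  · rw [indicator_of_notMem hx, indicator_of_notMem fun h => hx (h3.2 h)]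

/-- If a closed invariant subspace contains every function carried by `I`, then it contains every
function carried by the `i`-th preimage of `I` under the rotation. -/
theorem cutoff_preimage_mem (hφ : ContinuousOn φ (Icc 0 1)) {α : ℝ}
    (hT : DenseRange (weightedTranslation p (weightOfContinuousOn φ hφ) α))
    {K : Submodule ℂ (Lp ℂ p lebesgue01)} (hK : IsClosed (K : Set (Lp ℂ p lebesgue01)))
    (hTK : ∀ v ∈ K, weightedTranslation p (weightOfContinuousOn φ hφ) α v ∈ K)
    {I : Set ℝ} (hI : MeasurableSet I) (hIK : ∀ g, cutoff p hI g ∈ K) (i : ℕ)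
    (g : Lp ℂ p lebesgue01) : cutoff p (measurable_fract_add (i * α) hI) g ∈ K := by
  induction i generalizing g with
  | zero =>
    rw [cutoff_congr _ hI]
    · exact hIK g
    · filter_upwards [ae_fract_eq_self] with x hx
      simp [hx]
  | succ i ih =>
    have hset : ∀ x, x ∈ (fun x : ℝ => Int.fract (x + (i + 1 : ℕ) * α)) ⁻¹' I ↔
        x ∈ (fun x : ℝ => Int.fract (x + α)) ⁻¹'
          ((fun x : ℝ => Int.fract (x + i * α)) ⁻¹' I) := by
      intro x
      rw [mem_preimage, mem_preimage, mem_preimage, fract_fract_add]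
      push_cast
      rw [show x + ((i : ℝ) + 1) * α = x + α + i * α by ring]
    rw [cutoff_congr _ (measurable_fract_add α (measurable_fract_add (i * α) hI))
      (Filter.Eventually.of_forall hset)]
    refine hT.induction_on (p := fun g =>
      cutoff p (measurable_fract_add α (measurable_fract_add (i * α) hI)) g ∈ K) g
      (hK.preimage (ContinuousLinearMap.continuous _)) fun f => ?_
    rw [cutoff_preimage_comp hφ α (measurable_fract_add (i * α) hI)]
    exact hTK _ (ih f)

/-- A function carried by finitely many sets is the sum of its successive cutoffs. -/
theorem mem_of_cutoff_mem {K : Submodule ℂ (Lp ℂ p lebesgue01)} {E : ℕ → Set ℝ}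
    (hE : ∀ i, MeasurableSet (E i)) (hK : ∀ i g, cutoff p (hE i) g ∈ K) (N : ℕ)
    (g : Lp ℂ p lebesgue01) (hg : ∀ᵐ x ∂lebesgue01, g x ≠ 0 → ∃ i < N, x ∈ E i) : g ∈ K := by
  induction N generalizing g with
  | zero =>
    have : g = 0 := by
      refine Lp.ext ?_
      filter_upwards [hg, Lp.coeFn_zero ℂ p lebesgue01] with x hx h0
      rw [h0]
      by_contra h
      obtain ⟨i, hi, -⟩ := hx h
      exact Nat.not_lt_zero i hi
    rw [this]
    exact K.zero_mem
  | succ N ih =>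
    have hsplit : g = cutoff p (hE N) g + cutoff p (hE N).compl g := by
      refine Lp.ext ?_
      filter_upwards [cutoff_ae_eq (hE N) g, cutoff_ae_eq (hE N).compl g,
        Lp.coeFn_add (cutoff p (hE N) g) (cutoff p (hE N).compl g)] with x h1 h2 h3
      rw [h3, Pi.add_apply, h1, h2, indicator_self_add_compl_apply]
    rw [hsplit]
    refine K.add_mem (hK N g) (ih _ ?_)
    filter_upwards [hg, cutoff_ae_eq (hE N).compl g] with x hx h1 hne
    rw [h1] at hne
    have hxN : x ∈ (E N)ᶜ := mem_of_indicator_ne_zero hne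
    rw [indicator_of_mem hxN] at hne
    obtain ⟨i, hi, hxi⟩ := hx hne
    refine ⟨i, lt_of_le_of_ne (Nat.lt_succ_iff.1 hi) ?_, hxi⟩
    rintro rfl
    exact hxN hxi

/-- For a rational rotation, `T ^ q - a ^ q` is the multiplication by a function that vanishes on a
level set of `weightCocycle`, hence only on a null set. -/
theorem denseRange_weightedTranslation_sub (hp : p ≠ ∞) (hφ : ContinuousOn φ (Icc 0 1))
    (hincr : StrictMonoOn φ (Icc 0 1)) (h0 : φ 0 = 0) {q : ℕ} (hq : 0 < q) (r : ℤ) (a : ℂ) :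
    DenseRange (weightedTranslation p (weightOfContinuousOn φ hφ) (r / q)
      - algebraMap ℂ (Lp ℂ p lebesgue01 →L[ℂ] Lp ℂ p lebesgue01) a) := by
  refine denseRange_sub_algebraMap_of_pow (q := q) a ?_
  refine denseRange_of_ae_eq_mul hp
    (m := fun x => (weightCocycle φ (r / q) q x : ℂ) - a ^ q)
    ((Complex.measurable_ofReal.comp (measurable_weightCocycle hφ _ _)).sub_const _) ?_ ?_
  · filter_upwards [ae_weightCocycle_ne hq r hincr h0 (a ^ q)] with x hx
    exact sub_ne_zero.2 hx
  · intro f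
    have : (weightedTranslation p (weightOfContinuousOn φ hφ) (r / q) ^ q
        - algebraMap ℂ (Lp ℂ p lebesgue01 →L[ℂ] Lp ℂ p lebesgue01) (a ^ q)) f
        = (weightedTranslation p (weightOfContinuousOn φ hφ) (r / q) ^ q) f - a ^ q • f := by
      rw [sub_apply, Algebra.algebraMap_eq_smul_one]
      rfl
    rw [this]
    filter_upwards [weightedTranslation_pow_period_ae_eq hφ hq r f,
      Lp.coeFn_sub ((weightedTranslation p (weightOfContinuousOn φ hφ) (r / q) ^ q) f)
        (a ^ q • f), Lp.coeFn_smul (a ^ q) f] with x h1 h2 h3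
    rw [h2, Pi.sub_apply, h1, h3, Pi.smul_apply, smul_eq_mul, sub_mul]

/-- For a rational rotation in lowest terms, the indicator function of the first cell `(0, 1 / q)` is
a cyclic vector. -/
theorem isCyclicOperator_weightedTranslation_div (hp : p ≠ ∞) (hφ : ContinuousOn φ (Icc 0 1))
    (hincr : StrictMonoOn φ (Icc 0 1)) (h0 : φ 0 = 0) {q : ℕ} (hq : 0 < q) {r : ℤ}
    (hrq : IsCoprime r (q : ℤ)) :
    IsCyclicOperator (weightedTranslation p (weightOfContinuousOn φ hφ) (r / q)) := by
  have hq' : (0 : ℝ) < q := by exact_mod_cast hq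
  set T := weightedTranslation p (weightOfContinuousOn φ hφ) (r / q) with hTdef
  set Φ := weightCocycle φ (r / q) q
  set I : Set ℝ := Ioo 0 (1 / q)
  have hI : MeasurableSet I := measurableSet_Ioo
  set f : Lp ℂ p lebesgue01 := indicatorConstLp p hI (measure_ne_top _ _) 1 with hf
  refine ⟨f, ?_⟩
  set K := (Submodule.span ℂ (range fun n : ℕ => (T ^ n) f)).topologicalClosure with hKdef
  have hKclosed : IsClosed (K : Set (Lp ℂ p lebesgue01)) :=
    Submodule.isClosed_topologicalClosure _
  have hK : (K : Set (Lp ℂ p lebesgue01)) =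
      closure (range fun P : Polynomial ℂ => Polynomial.aeval T P f) := by
    rw [hKdef, Submodule.topologicalClosure_coe, span_orbit_eq_range_aeval]
  have hTK : ∀ v ∈ K, T v ∈ K := by
    have hmaps : MapsTo T (K : Set (Lp ℂ p lebesgue01)) K := by
      rw [hK]
      refine MapsTo.closure ?_ T.continuous
      rintro _ ⟨P, rfl⟩
      exact ⟨Polynomial.X * P, by simp⟩
    exact fun v hv => hmaps hv
  have hinj : InjOn Φ I := by
    refine (injOn_weightCocycle hq r hincr h0 0).mono fun x hx => ?_
    have h1 : 0 < q * x := mul_pos hq' hx.1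
    have h2 : q * x < 1 := by
      have := hx.2
      rwa [lt_div_iff₀ hq', mul_comm] at this
    have hfr : Int.fract (q * x) = q * x := Int.fract_eq_self.2 ⟨h1.le, h2⟩
    exact ⟨Int.floor_eq_zero_iff.2 ⟨h1.le, h2⟩, by rw [hfr]; exact h1.ne'⟩
  -- polynomials in `T ^ q` act on `f` as polynomials in `Φ`, and these are dense in `L^p(I)`
  have hIK : ∀ g, cutoff p hI g ∈ K := by
    intro g
    rw [← SetLike.mem_coe, hK, EMetric.mem_closure_iff]
    intro ε hε
    obtain ⟨δ, hδ0, hδε⟩ := exists_between hε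
    obtain ⟨P, hP⟩ := exists_polynomial_comp_eLpNorm_sub_le hp Fact.out hI
      (measurable_weightCocycle hφ (r / q) q) (weightCocycle_mem_Icc hincr h0 (r / q) q) hinj
      (Lp.stronglyMeasurable g).measurable (Lp.memLp g) hδ0.ne'
    refine ⟨_, ⟨P.comp (Polynomial.X ^ q), rfl⟩, lt_of_le_of_lt ?_ hδε⟩
    rw [edist_comm, Lp.edist_def]
    refine le_trans (le_of_eq ?_) hP
    rw [← eLpNorm_indicator_eq_eLpNorm_restrict hI]
    refine eLpNorm_congr_ae ?_
    have hcomp : Polynomial.aeval T (P.comp (Polynomial.X ^ q)) = Polynomial.aeval (T ^ q) P := by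
      simp [Polynomial.aeval_comp]
    simp only [hcomp]
    filter_upwards [aeval_ae_eq_mul (weightedTranslation_pow_period_ae_eq hφ hq r) P f,
      cutoff_ae_eq hI g, indicatorConstLp_coeFn (p := p) (hs := hI)
        (hμs := measure_ne_top lebesgue01 I) (c := (1 : ℂ))] with x h1 h2 h3
    rw [Pi.sub_apply, h1, h2, hf, h3]
    by_cases hx : x ∈ I <;> simp [hx]
  -- the rotates of the first cell cover almost everything, so `K` is the whole space
  have hT : DenseRange T := by
    simpa using denseRange_weightedTranslation_sub hp hφ hincr h0 hq r 0
  have htop : ∀ g, g ∈ K := by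
    intro g
    refine mem_of_cutoff_mem (fun i : ℕ => measurable_fract_add (i * (r / q)) hI)
      (cutoff_preimage_mem hφ hT hKclosed hTK hI hIK) q g ?_
    filter_upwards [ae_fract_natCast_mul_ne_zero hq] with x hx _
    exact exists_fract_add_mul_mem_Ioo hq hrq hx
  exact fun g => htop g

end Rational

/-! ### Generic cyclicity -/

theorem nontrivial_Lp_lebesgue01 (p : ℝ≥0∞) : Nontrivial (Lp ℂ p lebesgue01) := by
  have hne : NeZero lebesgue01 := by
    refine ⟨fun h => ?_⟩
    have huniv : lebesgue01 univ = 0 := by rw [h]; simp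
    simp [lebesgue01] at huniv
  refine ⟨indicatorConstLp p MeasurableSet.univ (measure_ne_top _ _) 1, 0, fun h => ?_⟩
  have h1 := indicatorConstLp_coeFn (p := p) (hs := MeasurableSet.univ)
    (hμs := measure_ne_top lebesgue01 univ) (c := (1 : ℂ))
  rw [h] at h1
  obtain ⟨x, hx, hx0⟩ := (h1.and (Lp.coeFn_zero ℂ p lebesgue01)).exists
  rw [hx0] at hx
  simp at hx

theorem dense_setOf_eq_ratCast : Dense {α : Icc (0 : ℝ) 1 | ∃ s : ℚ, (α : ℝ) = s} := by
  rw [dense_iff_inter_open]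
  rintro V hV ⟨α, hα⟩
  obtain ⟨O, hO, rfl⟩ := isOpen_induced_iff.1 hV
  have hcl : (α : ℝ) ∈ closure (Ioo (0 : ℝ) 1) := by
    rw [closure_Ioo zero_ne_one]
    exact α.2
  obtain ⟨s, hs⟩ := Rat.denseRange_cast.exists_mem_open (hO.inter isOpen_Ioo)
    (mem_closure_iff.1 hcl O hO hα)
  exact ⟨⟨s, hs.2.1.le, hs.2.2.le⟩, hs.1, s, rfl⟩

theorem mainTheorem12 (p : ℝ≥0∞) [Fact (1 ≤ p)] (hp_one : 1 < p) (hp_top : p < ∞)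
    (φ : ℝ → ℝ) (hφ_cont : ContinuousOn φ (Icc 0 1)) (hφ_incr : StrictMonoOn φ (Icc 0 1))
    (hφ_conv : ConvexOn ℝ (Icc 0 1) φ) (hφ_zero : φ 0 = 0)
    (hφ_hol : ∃ (U : Set ℂ) (F : ℂ → ℂ), IsOpen U ∧ (∀ x ∈ Icc (0 : ℝ) 1, (x : ℂ) ∈ U) ∧
      DifferentiableOn ℂ F U ∧ ∀ x ∈ Icc (0 : ℝ) 1, F (x : ℂ) = (φ x : ℂ)) :
    {α : Icc (0 : ℝ) 1 |
        IsCyclicOperator (weightedTranslation p (weightOfContinuousOn φ hφ_cont) (α : ℝ))} ∈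
      residual (Icc (0 : ℝ) 1) := by
  have hp : p ≠ ∞ := hp_top.ne
  have : Fact (p ≠ ∞) := ⟨hp⟩
  have := nontrivial_Lp_lebesgue01 p
  refine residual_isCyclicOperator (T := fun α : Icc (0 : ℝ) 1 =>
      weightedTranslation p (weightOfContinuousOn φ hφ_cont) (α : ℝ))
    (continuous_comp_parameter (continuous_weightedTranslation hp _) continuous_subtype_val)
    (dense_setOf_eq_ratCast.mono ?_)
  rintro α ⟨s, hs⟩
  have hq : 0 < s.den := s.den_pos
  have hcop : IsCoprime s.num (s.den : ℤ) := Rat.isCoprime_num_den s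
  have hval : (α : ℝ) = s.num / s.den := by rw [hs, Rat.cast_def]
  rw [mem_ofPred_eq, hval]
  exact dense_setOf_cyclic_vector
    (denseRange_weightedTranslation_sub hp hφ_cont hφ_incr hφ_zero hq s.num)
    (isCyclicOperator_weightedTranslation_div hp hφ_cont hφ_incr hφ_zero hq hcop)
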